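/- Let $p\ge 1$ and let $(Y,X^{(1)},\dots,X^{(p)})$ be a random vector in $\mathbb R^{p+1}$ with square integrable components, such that $\mathrm{Var}(Y)>0$ and $\mathrm{Var}(X^{(j)})>0$ for all $j\in\{1,\dots,p\}$. Let $(Y_i,X_i^{(1)},\dots,X_i^{(p)})_{i\ge 1}$ be independent copies of this vector. For $k\in\{1,\dots,p\}$ let $$\tau_k=\frac{\mathrm{Cov}(Y,X^{(k)})}{\mathrm{Var}(X^{(k)})},\qquad \theta_k=\frac{\mathrm{Cov}(Y,X^{(k)})}{\mathrm{Var}(Y)},$$ $$\hat\tau_k=\frac{\sum_{i=1}^n (Y_i-\overline Y)(X_i^{(k)}-\overline X^{(k)})}{\sum_{i=1}^n (X_i^{(k)}-\overline X^{(k)})^2},\qquad \hat\theta_k=\frac{\sum_{i=1}^n (Y_i-\overline Y)(X_i^{(k)}-\overline X^{(k)})}{\sum_{i=1}^n (Y_i-\overline Y)^2},$$ where $\overline Y=\frac1n\sum_{i=1}^n Y_i$ and $\overline X^{(k)}=\frac1n\sum_{i=1}^n X_i^{(k)}$ (a quotient with zero denominator is given the value $0$). Write $[\tau:\theta]=(\tau_1,\dots,\tau_p,\theta_1,\dots,\theta_p)^t$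 and $[\hat\tau:\hat\theta]=(\hat\tau_1,\dots,\hat\tau_p,\hat\theta_1,\dots,\hat\theta_p)^t$. Let $\varepsilon^{(k)}=Y-\mathrm{Proj}_{U^{(k)}}(Y)$ and $e^{(k)}=X^{(k)}-\mathrm{Proj}_{W}(X^{(k)})$, where $U^{(k)}$ and $W$ are the subspaces of $\mathbb L^2$ generated by $\{\mathbf 1,X^{(k)}\}$ and by $\{\mathbf 1,Y\}$ respectively, and $\mathrm{Proj}$ denotes orthogonal projection in $\mathbb L^2$. Assume that for all $j\in\{1,\dots,p\}$ $$\mathbb E\big((X^{(j)}-\mathbb E X^{(j)})^2(\varepsilon^{(j)})^2\big)<\infty\quad\text{and}\quad \mathbb E\big((Y-\mathbb E Y)^2(e^{(j)})^2\big)<\infty .$$ Let $C$ be the symmetric $2p\times 2p$ matrix such that, for $j,k\in\{1,\dots,p\}$, $$C_{j,k}=\mathbb E\big((X^{(j)}-\mathbb E X^{(j)})(X^{(k)}-\mathbb E X^{(k)})\varepsilon^{(j)}\varepsilon^{(k)}\big),\qquad C_{p+j,p+k}=\mathbb E\big((Y-\mathbb E Y)^2e^{(j)}e^{(k)}\big),$$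 $$C_{j,p+k}=\mathbb E\big((X^{(j)}-\mathbb E X^{(j)})(Y-\mathbb E Y)\varepsilon^{(j)}e^{(k)}\big),$$ and let $D$ be the diagonal $2p\times 2p$ matrix with $D_{j,j}=\mathrm{Var}(X^{(j)})^{-1}$ and $D_{p+j,p+j}=\mathrm{Var}(Y)^{-1}$ for $j\in\{1,\dots,p\}$. Then $DCD$ is positive semidefinite and, as $n\to\infty$, $$\sqrt n\,\big([\hat\tau:\hat\theta]-[\tau:\theta]\big)\ \xrightarrow{\ \mathcal L\ }\ \mathcal N_{2p}(0,\,DCD).$$ -/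

import Mathlib

open MeasureTheory ProbabilityTheory Filter

noncomputable section

namespace MarginalRegression

/-! ### Population quantities -/

section Population

variable {Ω : Type*} [MeasurableSpace Ω] (P : Measure Ω) [IsProbabilityMeasure P]

/-- The subspace of `L²(P)` generated by the constant variable `1` and the variable `W`. -/
def spanOne {W : Ω → ℝ} (hW : MemLp W 2 P) : Submodule ℝ (Lp ℝ 2 P) :=
  Submodule.span ℝ {(memLp_const (1 : ℝ)).toLp (fun _ : Ω => (1 : ℝ)), hW.toLp W}

instance {W : Ω → ℝ} (hW : MemLp W 2 P) : FiniteDimensional ℝ (spanOne P hW) :=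
  FiniteDimensional.span_of_finite ℝ (Set.toFinite _)

/-- `Z - Proj(Z)`, where `Proj` is the orthogonal projection of `L²(P)` onto the subspace
generated by `1` and `W` (a version of this element of `L²(P)`). -/
def residual {Z W : Ω → ℝ} (hZ : MemLp Z 2 P) (hW : MemLp W 2 P) : Ω → ℝ :=
  fun ω => Z ω - ((spanOne P hW).starProjection (hZ.toLp Z) : Lp ℝ 2 P) ω

/-- `τ_k = Cov(Y, X^(k)) / Var(X^(k))`. -/
def tau {p : ℕ} (Y : Ω → ℝ) (X : Fin p → Ω → ℝ) (k : Fin p) : ℝ :=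
  cov[Y, X k; P] / Var[X k; P]

/-- `θ_k = Cov(Y, X^(k)) / Var(Y)`. -/
def theta {p : ℕ} (Y : Ω → ℝ) (X : Fin p → Ω → ℝ) (k : Fin p) : ℝ :=
  cov[Y, X k; P] / Var[Y; P]

/-- The concatenated vector `[τ : θ]`; the first copy of `Fin p` indexes the coordinates
`1, …, p` and the second one the coordinates `p + 1, …, 2p`. -/
def tauTheta {p : ℕ} (Y : Ω → ℝ) (X : Fin p → Ω → ℝ) : EuclideanSpace ℝ (Fin p ⊕ Fin p) :=
  WithLp.toLp 2 (Sum.elim (tau P Y X) (theta P Y X))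

variable {p : ℕ} {Y : Ω → ℝ} {X : Fin p → Ω → ℝ}

/-- `ε^(k) = Y - Proj(Y)`, with the projection onto the span of `1` and `X^(k)`. -/
def eps (hY : MemLp Y 2 P) (hX : ∀ k, MemLp (X k) 2 P) (k : Fin p) : Ω → ℝ :=
  residual P hY (hX k)

/-- `e^(k) = X^(k) - Proj(X^(k))`, with the projection onto the span of `1` and `Y`. -/
def err (hY : MemLp Y 2 P) (hX : ∀ k, MemLp (X k) 2 P) (k : Fin p) : Ω → ℝ :=
  residual P (hX k) hY

/-- The upper right block of `C`, with entries
`E((X^(j) - E X^(j)) (Y - E Y) ε^(j) e^(k))`. -/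
def matCoff (hY : MemLp Y 2 P) (hX : ∀ k, MemLp (X k) 2 P) : Matrix (Fin p) (Fin p) ℝ :=
  Matrix.of fun j k => ∫ ω, (X j ω - P[X j]) * (Y ω - P[Y]) * eps P hY hX j ω * err P hY hX k ω ∂P

/-- The symmetric `2p × 2p` matrix `C`. -/
def matC (hY : MemLp Y 2 P) (hX : ∀ k, MemLp (X k) 2 P) :
    Matrix (Fin p ⊕ Fin p) (Fin p ⊕ Fin p) ℝ :=
  Matrix.fromBlocks
    (Matrix.of fun j k =>
      ∫ ω, (X j ω - P[X j]) * (X k ω - P[X k]) * eps P hY hX j ω * eps P hY hX k ω ∂P)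
    (matCoff P hY hX)
    (matCoff P hY hX).transpose
    (Matrix.of fun j k => ∫ ω, (Y ω - P[Y]) ^ 2 * err P hY hX j ω * err P hY hX k ω ∂P)

variable (Y X) in
/-- The diagonal `2p × 2p` matrix `D`. -/
def matD : Matrix (Fin p ⊕ Fin p) (Fin p ⊕ Fin p) ℝ :=
  Matrix.diagonal (Sum.elim (fun j => (Var[X j; P])⁻¹) (fun _ => (Var[Y; P])⁻¹))

end Population

/-! ### Empirical quantities -/

/-- The empirical mean of the first `n` terms of `z`. -/
def empMean (n : ℕ) (z : ℕ → ℝ) : ℝ := (∑ i ∈ Finset.range n, z i) / n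

/-- The empirical version of `τ_k`, from the data `(y i, x i)`, `i < n`. -/
def tauHat {p : ℕ} (n : ℕ) (y : ℕ → ℝ) (x : ℕ → Fin p → ℝ) (k : Fin p) : ℝ :=
  (∑ i ∈ Finset.range n, (y i - empMean n y) * (x i k - empMean n (fun l => x l k))) /
    ∑ i ∈ Finset.range n, (x i k - empMean n (fun l => x l k)) ^ 2

/-- The empirical version of `θ_k`, from the data `(y i, x i)`, `i < n`. -/
def thetaHat {p : ℕ} (n : ℕ) (y : ℕ → ℝ) (x : ℕ → Fin p → ℝ) (k : Fin p) : ℝ :=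
  (∑ i ∈ Finset.range n, (y i - empMean n y) * (x i k - empMean n (fun l => x l k))) /
    ∑ i ∈ Finset.range n, (y i - empMean n y) ^ 2

/-- The concatenated vector of empirical versions of `[τ : θ]`. -/
def tauThetaHat {p : ℕ} (n : ℕ) (y : ℕ → ℝ) (x : ℕ → Fin p → ℝ) :
    EuclideanSpace ℝ (Fin p ⊕ Fin p) :=
  WithLp.toLp 2 (Sum.elim (tauHat n y x) (thetaHat n y x))

end MarginalRegression

end

/-! Each coordinate of the estimator is a least squares slope: Y regressed on X^(k) for τ, X^(k)
regressed on Y for θ. So it suffices to prove a joint limit theorem for finitely many slopes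
computed from one sample.

For one regression let a be the regressor centered at its population mean, b the population slope, r
the population residual, s the empirical variance of the regressor. Whenever s ≠ 0,
`sqrt_mul_slopeHat_sub` gives the exact identity √n (b̂ - b) = s⁻¹ (n^(-1/2) ∑ a r - (n^(-1/2) ∑ a)
r̄). The scores a r are centered by the normal equations and square integrable by the moment
assumptions, so the vector central limit theorem applies jointly to all scores a r and all
regressors a. By the strong law s → Var and r̄ → 0, and Slutsky's theorem leaves only the scores
divided by the variances.

By `residual_ae_eq` the projection residuals ε and e are these r almost surely, so `DCD` is the
second moment matrix of the rescaled scores. This identifies the limit and gives positive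
semidefiniteness. -/

open scoped Matrix

/-! ### Second moment matrices and the multivariate central limit theorem -/

section VectorCLT

variable {Ω : Type*} [MeasurableSpace Ω] {P : Measure Ω} {κ : Type*} [Fintype κ]

/-- The matrix of second moments of a family of random variables. -/
noncomputable def secondMomentMatrix (P : Measure Ω) (V : κ → Ω → ℝ) : Matrix κ κ ℝ :=
  Matrix.of fun j k => ∫ ω, V j ω * V k ω ∂P

/-- Expanding the square turns the quadratic form into a second moment. This yields positivity, the
variance of one-dimensional projections, and comparisons of Gaussian covariances. -/
lemma dotProduct_secondMomentMatrix_mulVec {V : κ → Ω → ℝ} (hV : ∀ j, MemLp (V j) 2 P)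
    (x : κ → ℝ) :
    x ⬝ᵥ (secondMomentMatrix P V).mulVec x = ∫ ω, (∑ j, x j * V j ω) ^ 2 ∂P := by
  have hint (j k : κ) : Integrable (fun ω => x j * V j ω * (x k * V k ω)) P :=
    ((hV j).const_mul (x j)).integrable_mul ((hV k).const_mul (x k))
  simp_rw [sq, Finset.sum_mul_sum]
  rw [integral_finsetSum _ fun j _ => integrable_finsetSum _ fun k _ => hint j k]
  refine Finset.sum_congr rfl fun j _ => ?_
  rw [integral_finsetSum _ fun k _ => hint j k, Matrix.mulVec, dotProduct, Finset.mul_sum]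
  refine Finset.sum_congr rfl fun k _ => ?_
  rw [secondMomentMatrix, Matrix.of_apply, ← mul_assoc, mul_right_comm, ← integral_const_mul]
  exact integral_congr_ae (ae_of_all _ fun ω => by simp only; ring)

lemma posSemidef_secondMomentMatrix {V : κ → Ω → ℝ} (hV : ∀ j, MemLp (V j) 2 P) :
    (secondMomentMatrix P V).PosSemidef := by
  refine .of_dotProduct_mulVec_nonneg ?_ fun x => ?_
  · ext j k
    simp [secondMomentMatrix, mul_comm]
  · rw [star_trivial, dotProduct_secondMomentMatrix_mulVec hV]
    positivity

variable [DecidableEq κ]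

lemma charFun_multivariateGaussian_zero {S : Matrix κ κ ℝ} (hS : S.PosSemidef)
    (t : EuclideanSpace ℝ κ) :
    charFun (multivariateGaussian 0 S) t =
      Complex.exp (-((t.ofLp ⬝ᵥ S.mulVec t.ofLp : ℝ) : ℂ) / 2) := by
  rw [charFun_multivariateGaussian hS]
  simp [neg_div]

lemma charFun_map_inner {E : Type*} [NormedAddCommGroup E] [InnerProductSpace ℝ E]
    [MeasurableSpace E] [BorelSpace E] [SecondCountableTopology E] {f : Ω → E}
    (hf : AEMeasurable f P) (t : E) :
    charFun (P.map fun ω => inner ℝ (f ω) t) 1 = charFun (P.map f) t := by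
  rw [charFun_apply, charFun_apply, integral_map (by fun_prop) (by fun_prop),
    integral_map hf (by fun_prop)]
  simp

/-- `M` plays the role of the adjoint of `L`: the characteristic function of the image at `t` is the
original one at `M t`. Only quadratic forms need comparing, so degenerate covariances are allowed.
-/
lemma map_multivariateGaussian {ι : Type*} [Fintype ι] [DecidableEq ι] {S : Matrix κ κ ℝ}
    {T : Matrix ι ι ℝ} (hS : S.PosSemidef) (hT : T.PosSemidef)
    {L : EuclideanSpace ℝ κ → EuclideanSpace ℝ ι} (hL : Measurable L)
    (M : EuclideanSpace ℝ ι → EuclideanSpace ℝ κ)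
    (hLM : ∀ x t, inner ℝ (L x) t = inner ℝ x (M t))
    (hST : ∀ t, (M t).ofLp ⬝ᵥ S.mulVec (M t).ofLp = t.ofLp ⬝ᵥ T.mulVec t.ofLp) :
    (multivariateGaussian 0 S).map L = multivariateGaussian 0 T := by
  have := Measure.isProbabilityMeasure_map (μ := multivariateGaussian 0 S) hL.aemeasurable
  refine Measure.ext_of_charFun (funext fun t => ?_)
  rw [charFun_multivariateGaussian_zero hT, ← hST, ← charFun_multivariateGaussian_zero hS,
    charFun_apply, charFun_apply, integral_map hL.aemeasurable (by fun_prop)]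
  simp_rw [hLM]

/-- The multivariate central limit theorem, for centered vectors. -/
theorem tendstoInDistribution_inv_sqrt_smul_sum [IsProbabilityMeasure P]
    {V : ℕ → Ω → EuclideanSpace ℝ κ} {S : Matrix κ κ ℝ}
    (hmem : ∀ j, MemLp (fun ω => V 0 ω j) 2 P) (hmean : ∀ j, ∫ ω, V 0 ω j ∂P = 0)
    (hS : S = secondMomentMatrix P fun j ω => V 0 ω j)
    (hindep : iIndepFun V P) (hident : ∀ i, IdentDistrib (V i) (V 0) P P) :
    TendstoInDistribution (fun (n : ℕ) ω => (Real.sqrt n)⁻¹ • ∑ i ∈ Finset.range n, V i ω) atTop id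
      (fun _ => P) (multivariateGaussian 0 S) where
  forall_aemeasurable n :=
    (Finset.aemeasurable_fun_sum _ fun i _ => (hident i).aemeasurable_fst).const_smul (Real.sqrt n)⁻¹
  tendsto := by
    have hm (i : ℕ) : AEMeasurable (V i) P := (hident i).aemeasurable_fst
    -- Cramér–Wold through Lévy's continuity theorem: for fixed `t`, the scalar central limit
    -- theorem is applied to the inner products with `t`, and its characteristic functions are read
    -- at 1.
    refine ProbabilityMeasure.tendsto_iff_tendsto_charFun.2 fun t => ?_
    have hinner : Measurable fun x : EuclideanSpace ℝ κ => inner ℝ x t := by fun_prop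
    let W : ℕ → Ω → ℝ := fun i ω => inner ℝ (V i ω) t
    have hW0 (ω : Ω) : W 0 ω = ∑ j, t j * V 0 ω j := by simp [W, PiLp.inner_apply]
    have hW0' : W 0 = fun ω => ∑ j, t j * V 0 ω j := funext hW0
    have hWm : MemLp (W 0) 2 P := by
      rw [hW0']
      exact memLp_finsetSum _ fun j _ => (hmem j).const_mul (t j)
    have hWmean : ∫ ω, W 0 ω ∂P = 0 := by
      simp_rw [hW0]
      rw [integral_finsetSum _ fun j _ => ((hmem j).integrable (by simp)).const_mul (t j)]
      simp [integral_const_mul, hmean]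
    have hvar : Var[W 0; P] = t.ofLp ⬝ᵥ S.mulVec t.ofLp := by
      rw [variance_of_integral_eq_zero hWm.aemeasurable hWmean, hS,
        dotProduct_secondMomentMatrix_mulVec hmem]
      simp_rw [hW0]
    have hclt := tendstoInDistribution_inv_sqrt_mul_sum_sub
      (Y := id) (P' := gaussianReal 0 Var[W 0; P].toNNReal) .id hWm
      (hindep.comp (fun _ x => inner ℝ x t) fun _ => hinner) fun i => (hident i).comp hinner
    have hlim := ProbabilityMeasure.tendsto_iff_tendsto_charFun.1 hclt.tendsto 1
    have hSpos : S.PosSemidef := hS ▸ posSemidef_secondMomentMatrix hmem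
    simp only [ProbabilityMeasure.coe_mk, Measure.map_id] at hlim ⊢
    rw [charFun_gaussianReal, Real.coe_toNNReal _ (variance_nonneg _ _), hvar] at hlim
    rw [charFun_multivariateGaussian_zero hSpos]
    convert hlim using 2 with n
    · have hsum : AEMeasurable (fun ω => (Real.sqrt n)⁻¹ • ∑ i ∈ Finset.range n, V i ω) P :=
        (Finset.aemeasurable_fun_sum _ fun i _ => hm i).const_smul (Real.sqrt n)⁻¹
      rw [← charFun_map_inner hsum, hWmean]
      simp [inner_smul_left, sum_inner, W]
    · push_cast
      ring_nf

end VectorCLT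

namespace MarginalRegression

/-! ### Projection residuals in coordinates -/

section Residual

variable {Ω : Type*} [MeasurableSpace Ω] (P : Measure Ω) [IsProbabilityMeasure P]

/-- The least squares residual is orthogonal to the centered regressor. -/
lemma integral_centered_mul_residual {Z W : Ω → ℝ} (hZ : MemLp Z 2 P) (hW : MemLp W 2 P)
    (hVar : Var[W; P] ≠ 0) :
    ∫ ω, (W ω - P[W]) * ((Z ω - P[Z]) - cov[Z, W; P] / Var[W; P] * (W ω - P[W])) ∂P = 0 := by
  have hZc : MemLp (fun ω => Z ω - P[Z]) 2 P := hZ.sub (memLp_const _)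
  have hWc : MemLp (fun ω => W ω - P[W]) 2 P := hW.sub (memLp_const _)
  have hZW : Integrable (fun ω => (Z ω - P[Z]) * (W ω - P[W])) P := hZc.integrable_mul hWc
  set c : ℝ := cov[Z, W; P] / Var[W; P] with hc
  have hrw (ω : Ω) : (W ω - P[W]) * ((Z ω - P[Z]) - c * (W ω - P[W])) =
      (Z ω - P[Z]) * (W ω - P[W]) - c * (W ω - P[W]) ^ 2 := by ring
  simp_rw [hrw]
  rw [integral_sub hZW (hWc.integrable_sq.const_mul c), integral_const_mul,
    ← variance_eq_integral hW.aemeasurable, hc, div_mul_cancel₀ _ hVar]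
  exact sub_self _

lemma integral_centered {Z : Ω → ℝ} (hZ : Integrable Z P) : ∫ ω, (Z ω - P[Z]) ∂P = 0 := by
  rw [integral_sub hZ (by simp)]
  simp

/-- The least squares residual has mean zero. -/
lemma integral_residual {Z W : Ω → ℝ} (hZ : Integrable Z P) (hW : Integrable W P) (c : ℝ) :
    ∫ ω, ((Z ω - P[Z]) - c * (W ω - P[W])) ∂P = 0 := by
  have hZc : Integrable (fun ω => Z ω - P[Z]) P := hZ.sub (integrable_const _)
  have hWc : Integrable (fun ω => W ω - P[W]) P := hW.sub (integrable_const _)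
  rw [integral_sub hZc (hWc.const_mul c), integral_const_mul, integral_centered P hZ,
    integral_centered P hW]
  simp

/-- The residual of a simple linear regression, in coordinates. -/
lemma residual_ae_eq {Z W : Ω → ℝ} (hZ : MemLp Z 2 P) (hW : MemLp W 2 P) (hVar : Var[W; P] ≠ 0) :
    residual P hZ hW =ᵐ[P]
      fun ω => (Z ω - P[Z]) - cov[Z, W; P] / Var[W; P] * (W ω - P[W]) := by
  set c : ℝ := cov[Z, W; P] / Var[W; P] with hc
  have hone : MemLp (fun _ : Ω => (1 : ℝ)) 2 P := memLp_const 1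
  -- The population regression line, written in the generators 1 and `W`. It is the projection
  -- because its residual is orthogonal to both.
  set q : Lp ℝ 2 P := (P[Z] - c * P[W]) • hone.toLp _ + c • hW.toLp W with hq
  have hqcoe : q =ᵐ[P] fun ω => P[Z] + c * (W ω - P[W]) := by
    filter_upwards [Lp.coeFn_add ((P[Z] - c * P[W]) • hone.toLp _) (c • hW.toLp W),
      Lp.coeFn_smul (P[Z] - c * P[W]) (hone.toLp _), Lp.coeFn_smul c (hW.toLp W),
      hone.coeFn_toLp, hW.coeFn_toLp] with ω h1 h2 h3 h4 h5
    rw [hq, h1, Pi.add_apply, h2, h3, Pi.smul_apply, Pi.smul_apply, h4, h5, smul_eq_mul,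
      smul_eq_mul]
    ring
  have hres : ((hZ.toLp Z - q : Lp ℝ 2 P) : Ω → ℝ) =ᵐ[P]
      fun ω => (Z ω - P[Z]) - c * (W ω - P[W]) := by
    filter_upwards [Lp.coeFn_sub (hZ.toLp Z) q, hqcoe, hZ.coeFn_toLp] with ω h1 h2 h3
    rw [h1, Pi.sub_apply, h2, h3]
    ring
  have hZi := hZ.integrable (by simp)
  have hWi := hW.integrable (by simp)
  have hZc : MemLp (fun ω => Z ω - P[Z]) 2 P := hZ.sub (memLp_const _)
  have hWc : MemLp (fun ω => W ω - P[W]) 2 P := hW.sub (memLp_const _)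
  have hr : MemLp (fun ω => (Z ω - P[Z]) - c * (W ω - P[W])) 2 P := hZc.sub (hWc.const_mul c)
  have hmean := integral_residual P hZi hWi c
  have horth := integral_centered_mul_residual P hZ hW hVar
  have hproj : (spanOne P hW).starProjection (hZ.toLp Z) = q := by
    refine Submodule.eq_starProjection_of_mem_of_inner_eq_zero
      (Submodule.mem_span_pair.2 ⟨_, _, rfl⟩) fun w hw => ?_
    obtain ⟨a, b, rfl⟩ := Submodule.mem_span_pair.1 hw
    have h1 : inner ℝ (hZ.toLp Z - q) (hone.toLp _) = 0 := by
      rw [L2.inner_def, ← hmean]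
      refine integral_congr_ae ?_
      filter_upwards [hres, hone.coeFn_toLp] with ω h1 h2
      rw [h1, h2]
      simp
    have h2 : inner ℝ (hZ.toLp Z - q) (hW.toLp W) = 0 := by
      have : ∫ ω, ((Z ω - P[Z]) - c * (W ω - P[W])) * W ω ∂P = 0 := by
        have hrw (ω : Ω) : ((Z ω - P[Z]) - c * (W ω - P[W])) * W ω =
            (W ω - P[W]) * ((Z ω - P[Z]) - c * (W ω - P[W])) +
              ((Z ω - P[Z]) - c * (W ω - P[W])) * P[W] := by ring
        have hint : Integrable (fun ω => (W ω - P[W]) * ((Z ω - P[Z]) - c * (W ω - P[W]))) P :=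
          hWc.integrable_mul hr
        simp_rw [hrw]
        rw [integral_add hint ((hr.integrable (by simp)).mul_const _), horth,
          integral_mul_const, hmean, zero_mul, add_zero]
      rw [L2.inner_def, ← this]
      refine integral_congr_ae ?_
      filter_upwards [hres, hW.coeFn_toLp] with ω h1 h2
      rw [h1, h2]
      simp [mul_comm]
    rw [inner_add_right, inner_smul_right, inner_smul_right, h1, h2]
    simp
  filter_upwards [hqcoe] with ω hω
  rw [residual, hproj, hω]
  ring

end Residual

/-! ### Algebra of the empirical slope -/

section Slope

/-- The slope of the least squares regression of `y` on `x` over the first `n` observations. -/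
noncomputable def slopeHat (n : ℕ) (y x : ℕ → ℝ) : ℝ :=
  (∑ i ∈ Finset.range n, (y i - empMean n y) * (x i - empMean n x)) /
    ∑ i ∈ Finset.range n, (x i - empMean n x) ^ 2

/-- The constants `m`, `l` are arbitrary, which allows empirical means to be replaced by population
means at the cost of a product of two sums. -/
lemma sum_sub_empMean_mul_sub_empMean {n : ℕ} (hn : n ≠ 0) (y x : ℕ → ℝ) (m l : ℝ) :
    ∑ i ∈ Finset.range n, (y i - empMean n y) * (x i - empMean n x) =
      ∑ i ∈ Finset.range n, (y i - m) * (x i - l) -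
        (∑ i ∈ Finset.range n, (y i - m)) * (∑ i ∈ Finset.range n, (x i - l)) / n := by
  have hn' : (n : ℝ) ≠ 0 := by exact_mod_cast hn
  simp only [sub_mul, mul_sub, Finset.sum_sub_distrib, ← Finset.sum_mul, ← Finset.mul_sum,
    Finset.sum_const, Finset.card_range, nsmul_eq_mul, empMean]
  field_simp
  ring

lemma sum_sub_empMean_sq {n : ℕ} (hn : n ≠ 0) (x : ℕ → ℝ) (l : ℝ) :
    ∑ i ∈ Finset.range n, (x i - empMean n x) ^ 2 =
      n * ((∑ i ∈ Finset.range n, (x i - l) ^ 2) / n -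
        ((∑ i ∈ Finset.range n, (x i - l)) / n) ^ 2) := by
  have hn' : (n : ℝ) ≠ 0 := by exact_mod_cast hn
  simp_rw [sq (_ - empMean n x), sum_sub_empMean_mul_sub_empMean hn x x l l, ← sq]
  field_simp

/-- The linearization of the estimation error of the slope. -/
lemma sqrt_mul_slopeHat_sub {n : ℕ} (y x : ℕ → ℝ) (m l b : ℝ)
    (hs : (∑ i ∈ Finset.range n, (x i - l) ^ 2) / n -
        ((∑ i ∈ Finset.range n, (x i - l)) / n) ^ 2 ≠ 0) :
    Real.sqrt n * (slopeHat n y x - b) =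
      ((Real.sqrt n)⁻¹ * (∑ i ∈ Finset.range n, (x i - l) * ((y i - m) - b * (x i - l))) -
        ((Real.sqrt n)⁻¹ * ∑ i ∈ Finset.range n, (x i - l)) *
          ((∑ i ∈ Finset.range n, ((y i - m) - b * (x i - l))) / n)) *
        ((∑ i ∈ Finset.range n, (x i - l) ^ 2) / n -
          ((∑ i ∈ Finset.range n, (x i - l)) / n) ^ 2)⁻¹ := by
  -- At `n = 0` both empirical moments are 0, contradicting `hs`.
  have hn : n ≠ 0 := by
    rintro rfl
    simp at hs
  have hn' : (0 : ℝ) < n := by exact_mod_cast Nat.pos_of_ne_zero hn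
  have hexp : ∑ i ∈ Finset.range n, (x i - l) * ((y i - m) - b * (x i - l)) =
      ∑ i ∈ Finset.range n, (y i - m) * (x i - l) - b * ∑ i ∈ Finset.range n, (x i - l) ^ 2 := by
    rw [Finset.mul_sum, ← Finset.sum_sub_distrib]
    exact Finset.sum_congr rfl fun i _ => by ring
  rw [slopeHat, sum_sub_empMean_mul_sub_empMean hn y x m l, sum_sub_empMean_sq hn x l, hexp,
    Finset.sum_sub_distrib (f := fun i => y i - m), ← Finset.mul_sum]
  set A := ∑ i ∈ Finset.range n, (x i - l)
  set B := ∑ i ∈ Finset.range n, (x i - l) ^ 2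
  set s := B / n - (A / n) ^ 2 with hsdef
  -- Solving for `B` lets `s` become a free nonzero variable; with √n abstracted as well, the claim
  -- is a rational identity.
  have hB : B = n * s + A ^ 2 / n := by rw [hsdef]; field_simp; ring
  have hr : Real.sqrt n ≠ 0 := (Real.sqrt_pos.2 hn').ne'
  have hrr : (n : ℝ) = Real.sqrt n ^ 2 := (Real.sq_sqrt hn'.le).symm
  clear_value s
  rw [hB]
  generalize Real.sqrt n = r at *
  rw [hrr]
  field_simp
  ring

end Slope

end MarginalRegression

namespace MarginalRegression

/-! ### Joint asymptotic normality of slopes -/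

section SlopeCLT

variable {Ω₀ : Type*} [MeasurableSpace Ω₀] {P₀ : Measure Ω₀}
  {Ω : Type*} [MeasurableSpace Ω] {P : Measure Ω}
  {E : Type*} [MeasurableSpace E] {Q : Ω₀ → E} {Qs : ℕ → Ω → E}

lemma strong_law_of_copies (hindep : iIndepFun Qs P) (hident : ∀ i, IdentDistrib (Qs i) Q P P₀)
    {f : E → ℝ} (hf : Measurable f) (hint : Integrable (fun ω => f (Q ω)) P₀) :
    ∀ᵐ ω ∂P, Tendsto (fun n : ℕ => (∑ i ∈ Finset.range n, f (Qs i ω)) / n) atTop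
      (nhds (∫ ω, f (Q ω) ∂P₀)) := by
  have hfident (i : ℕ) : IdentDistrib (f ∘ Qs i) (f ∘ Q) P P₀ := (hident i).comp hf
  have hslln := strong_law_ae_real (fun i => f ∘ Qs i) ((hfident 0).integrable_iff.2 hint)
    (fun i j hij => (hindep.indepFun hij).comp hf hf)
    fun i => (hfident i).trans (hfident 0).symm
  rw [(hfident 0).integral_eq] at hslln
  exact hslln

variable [IsProbabilityMeasure P₀] [IsProbabilityMeasure P]
  {ι : Type*} [Fintype ι] [DecidableEq ι]

/-- Joint asymptotic normality of finitely many least squares slopes computed from the same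
sample: `u j` is the regressor and `w j` is the response of the `j`-th regression. -/
theorem tendstoInDistribution_slopeHat (hindep : iIndepFun Qs P)
    (hident : ∀ i, IdentDistrib (Qs i) Q P P₀) {u w : ι → E → ℝ}
    (hum : ∀ j, Measurable (u j)) (hwm : ∀ j, Measurable (w j)) {U W : ι → Ω₀ → ℝ}
    (hU : ∀ j ω, U j ω = u j (Q ω)) (hW : ∀ j ω, W j ω = w j (Q ω))
    (hU2 : ∀ j, MemLp (U j) 2 P₀) (hW2 : ∀ j, MemLp (W j) 2 P₀) (hVar : ∀ j, Var[U j; P₀] ≠ 0)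
    {b : ι → ℝ} (hb : ∀ j, b j = cov[W j, U j; P₀] / Var[U j; P₀])
    {G : ι → Ω₀ → ℝ}
    (hG : ∀ j ω, G j ω = (U j ω - P₀[U j]) * ((W j ω - P₀[W j]) - b j * (U j ω - P₀[U j])))
    (hG2 : ∀ j, MemLp (G j) 2 P₀) :
    TendstoInDistribution
      (fun (n : ℕ) ω => Real.sqrt n •
        (WithLp.toLp 2 (fun j => slopeHat n (fun i => w j (Qs i ω)) (fun i => u j (Qs i ω))) -
          WithLp.toLp 2 b : EuclideanSpace ℝ ι))
      atTop id (fun _ => P)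
      (multivariateGaussian 0
        (secondMomentMatrix P₀ fun j ω => (Var[U j; P₀])⁻¹ * G j ω)) := by
  have hQs (i : ℕ) : AEMeasurable (Qs i) P := (hident i).aemeasurable_fst
  -- centered regressors and residuals, as functions of one observation
  set a : ι → E → ℝ := fun j q => u j q - P₀[U j] with ha
  set r : ι → E → ℝ := fun j q => (w j q - P₀[W j]) - b j * a j q with hr
  have ham (j : ι) : Measurable (a j) := (hum j).sub_const _
  have hrm (j : ι) : Measurable (r j) := ((hwm j).sub_const _).sub ((ham j).const_mul _)
  have haQ (j : ι) : (fun ω => a j (Q ω)) = fun ω => U j ω - P₀[U j] := by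
    funext ω; simp only [ha, hU]
  have hrQ (j : ι) : (fun ω => r j (Q ω)) =
      fun ω => (W j ω - P₀[W j]) - b j * (U j ω - P₀[U j]) := by
    funext ω; simp only [hr, ha, hU, hW]
  have hGQ (j : ι) : G j = fun ω => a j (Q ω) * r j (Q ω) := by
    funext ω; rw [hG]; simp only [hr, ha, hU, hW]
  have ha2 (j : ι) : MemLp (fun ω => a j (Q ω)) 2 P₀ := by
    rw [haQ]; exact (hU2 j).sub (memLp_const _)
  have hr2 (j : ι) : MemLp (fun ω => r j (Q ω)) 2 P₀ := by
    rw [hrQ]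
    exact ((hW2 j).sub (memLp_const _)).sub (((hU2 j).sub (memLp_const _)).const_mul _)
  have ha0 (j : ι) : ∫ ω, a j (Q ω) ∂P₀ = 0 := by
    rw [haQ]; exact integral_centered P₀ ((hU2 j).integrable (by simp))
  have hr0 (j : ι) : ∫ ω, r j (Q ω) ∂P₀ = 0 := by
    rw [hrQ]
    exact integral_residual P₀ ((hW2 j).integrable (by simp)) ((hU2 j).integrable (by simp)) _
  have hG0 (j : ι) : ∫ ω, G j ω ∂P₀ = 0 := by
    simp_rw [hG, hb]
    exact integral_centered_mul_residual P₀ (hW2 j) (hU2 j) (hVar j)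
  have hasq (j : ι) : ∫ ω, a j (Q ω) ^ 2 ∂P₀ = Var[U j; P₀] := by
    rw [variance_eq_integral (hU2 j).aemeasurable]
    simp only [ha, hU]
  -- the central limit theorem for the pairs (score, centered regressor)
  set V : ι ⊕ ι → Ω₀ → ℝ := Sum.elim G fun j ω => a j (Q ω) with hV
  set h : E → EuclideanSpace ℝ (ι ⊕ ι) := fun q =>
    WithLp.toLp 2 (Sum.elim (fun j => a j q * r j q) fun j => a j q) with hh
  have hhm : Measurable h := by
    refine (WithLp.measurable_toLp 2 _).comp (measurable_pi_lambda _ ?_)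
    rintro (j | j)
    · exact (ham j).mul (hrm j)
    · exact ham j
  have hhV (k : ι ⊕ ι) : (fun ω => h (Q ω) k) = V k := by
    rcases k with j | j
    · simp [hV, hh, hGQ]
    · simp [hV, hh]
  have hV2 : ∀ k, MemLp (V k) 2 P₀ := by
    rintro (j | j)
    · exact hG2 j
    · exact ha2 j
  have hV0 : ∀ k, ∫ ω, V k ω ∂P₀ = 0 := by
    rintro (j | j)
    · exact hG0 j
    · exact ha0 j
  have hhident (i : ℕ) : IdentDistrib (h ∘ Qs i) (h ∘ Q) P P₀ := (hident i).comp hhm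
  have hcoord (k : ι ⊕ ι) : IdentDistrib (fun ω => h (Qs 0 ω) k) (V k) P P₀ := by
    rw [← hhV]
    exact (hhident 0).comp (u := fun x : EuclideanSpace ℝ (ι ⊕ ι) => x k) (by fun_prop)
  have hclt := tendstoInDistribution_inv_sqrt_smul_sum (P := P) (V := fun i => h ∘ Qs i)
    (S := secondMomentMatrix P₀ V) (fun k => (hcoord k).memLp_iff.2 (hV2 k))
    (fun k => (hcoord k).integral_eq.trans (hV0 k))
    (by
      ext k l
      have hkl := ((hhident 0).comp
        (u := fun x : EuclideanSpace ℝ (ι ⊕ ι) => x k * x l) (by fun_prop)).integral_eq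
      simp only [secondMomentMatrix, Matrix.of_apply, ← hhV]
      exact hkl.symm)
    (hindep.comp (fun _ => h) fun _ => hhm) fun i => (hhident i).trans (hhident 0).symm
  -- the almost sure limits of the variances and of the means of the residuals
  set s : ℕ → ι → Ω → ℝ := fun n j ω => (∑ i ∈ Finset.range n, a j (Qs i ω) ^ 2) / n -
    ((∑ i ∈ Finset.range n, a j (Qs i ω)) / n) ^ 2 with hs
  set rbar : ℕ → ι → Ω → ℝ := fun n j ω => (∑ i ∈ Finset.range n, r j (Qs i ω)) / n with hrbar
  have hslim : ∀ᵐ ω ∂P, ∀ j, Tendsto (fun n => s n j ω) atTop (nhds Var[U j; P₀]) := by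
    refine ae_all_iff.2 fun j => ?_
    filter_upwards [strong_law_of_copies hindep hident ((ham j).pow_const 2) (ha2 j).integrable_sq,
      strong_law_of_copies hindep hident (ham j) ((ha2 j).integrable (by simp))] with ω h1 h2
    rw [hasq] at h1
    rw [ha0] at h2
    simpa using h1.sub (h2.pow 2)
  have hrlim : ∀ᵐ ω ∂P, ∀ j, Tendsto (fun n => rbar n j ω) atTop (nhds 0) := by
    refine ae_all_iff.2 fun j => ?_
    filter_upwards [strong_law_of_copies hindep hident (hrm j)
      ((hr2 j).integrable (by simp))] with ω h1
    rwa [hr0] at h1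
  have hsm (n : ℕ) (j : ι) : AEMeasurable (s n j) P := by
    refine ((Finset.aemeasurable_fun_sum _ fun i _ => ?_).div_const _).sub
      (((Finset.aemeasurable_fun_sum _ fun i _ => ?_).div_const _).pow_const 2)
    · exact ((ham j).comp_aemeasurable (hQs i)).pow_const 2
    · exact (ham j).comp_aemeasurable (hQs i)
  have hrbarm (n : ℕ) (j : ι) : AEMeasurable (rbar n j) P :=
    (Finset.aemeasurable_fun_sum _ fun i _ => (hrm j).comp_aemeasurable (hQs i)).div_const _
  set Z : ℕ → Ω → (ι → ℝ) × (ι → ℝ) := fun n ω => (fun j => (s n j ω)⁻¹, fun j => rbar n j ω)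
    with hZ
  have hZm (n : ℕ) : AEMeasurable (Z n) P :=
    (aemeasurable_pi_lambda _ fun j => (hsm n j).inv).prodMk
      (aemeasurable_pi_lambda _ fun j => hrbarm n j)
  have hZlim : TendstoInMeasure P Z atTop fun _ => (fun j => (Var[U j; P₀])⁻¹, fun _ => 0) := by
    refine tendstoInMeasure_of_tendsto_ae (fun n => (hZm n).aestronglyMeasurable) ?_
    filter_upwards [hslim, hrlim] with ω h1 h2
    exact (tendsto_pi_nhds.2 fun j => (h1 j).inv₀ (hVar j)).prodMk_nhds
      (tendsto_pi_nhds.2 fun j => h2 j)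
  -- Slutsky's theorem
  set g : EuclideanSpace ℝ (ι ⊕ ι) × ((ι → ℝ) × (ι → ℝ)) → EuclideanSpace ℝ ι := fun x =>
    WithLp.toLp 2 fun j => (x.1 (Sum.inl j) - x.1 (Sum.inr j) * x.2.2 j) * x.2.1 j with hg
  have hgc : Continuous g := by
    refine (PiLp.continuous_toLp 2 _).comp (continuous_pi fun j => ?_)
    fun_prop
  have hlin := hclt.continuous_comp_prodMk_of_tendstoInMeasure_const hgc hZlim hZm
  -- At r̄ = 0 the regressor block drops out, so `L` is linear: it keeps the score block and divides
  -- it by the variances.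
  set L : EuclideanSpace ℝ (ι ⊕ ι) → EuclideanSpace ℝ ι := fun x =>
    g (id x, (fun j => (Var[U j; P₀])⁻¹, fun _ => 0)) with hL
  have hLm : Measurable L := (hgc.comp (by fun_prop)).measurable
  have hGs2 (j : ι) : MemLp (fun ω => (Var[U j; P₀])⁻¹ * G j ω) 2 P₀ := (hG2 j).const_mul _
  have hmap : (multivariateGaussian 0 (secondMomentMatrix P₀ V)).map L =
      multivariateGaussian 0 (secondMomentMatrix P₀ fun j ω => (Var[U j; P₀])⁻¹ * G j ω) := by
    refine map_multivariateGaussian (posSemidef_secondMomentMatrix hV2)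
      (posSemidef_secondMomentMatrix hGs2) hLm
      -- The adjoint of `L`: rescale and pad the regressor block with zeros.
      (fun t => WithLp.toLp 2 (Sum.elim (fun j => (Var[U j; P₀])⁻¹ * t j) fun _ => 0)) ?_ ?_
    · intro x t
      simp only [hL, hg, PiLp.inner_apply, Fintype.sum_sum_type]
      simp [mul_assoc, mul_comm, mul_left_comm]
    · intro t
      rw [dotProduct_secondMomentMatrix_mulVec hV2, dotProduct_secondMomentMatrix_mulVec hGs2]
      simp only [Fintype.sum_sum_type, hV, Sum.elim_inl, Sum.elim_inr, zero_mul,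
        Finset.sum_const_zero, add_zero]
      simp only [mul_assoc, mul_left_comm]
  set T : ℕ → Ω → EuclideanSpace ℝ ι := fun n ω => g ((Real.sqrt n)⁻¹ •
    ∑ i ∈ Finset.range n, (h ∘ Qs i) ω, Z n ω) with hT
  have hTlim : TendstoInDistribution T atTop id (fun _ => P)
      (multivariateGaussian 0 (secondMomentMatrix P₀ fun j ω => (Var[U j; P₀])⁻¹ * G j ω)) := by
    refine ⟨hlin.forall_aemeasurable, aemeasurable_id, ?_⟩
    have hlim := hlin.tendsto
    convert hlim using 3
    exact congrArg nhds (Subtype.ext (Measure.map_id.trans hmap.symm))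
  have hslope (n : ℕ) (j : ι) : AEMeasurable
      (fun ω => slopeHat n (fun i => w j (Qs i ω)) fun i => u j (Qs i ω)) P := by
    have h1 (i : ℕ) : AEMeasurable (fun ω => u j (Qs i ω)) P :=
      (hum j).comp_aemeasurable (hQs i)
    have h2 (i : ℕ) : AEMeasurable (fun ω => w j (Qs i ω)) P :=
      (hwm j).comp_aemeasurable (hQs i)
    unfold slopeHat empMean
    fun_prop
  have hestm (n : ℕ) : AEMeasurable (fun ω => Real.sqrt n •
      (WithLp.toLp 2 (fun j => slopeHat n (fun i => w j (Qs i ω)) (fun i => u j (Qs i ω))) -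
        WithLp.toLp 2 b : EuclideanSpace ℝ ι)) P :=
    (((WithLp.measurable_toLp 2 _).comp_aemeasurable
      (aemeasurable_pi_lambda _ fun j => hslope n j)).sub_const _).const_smul (Real.sqrt n)
  -- Almost surely all empirical variances are nonzero for large `n`. From then on the linearization
  -- is exact, so the difference from `T` is eventually 0.
  refine tendstoInDistribution_of_tendstoInMeasure_sub _ _ hTlim ?_ hestm
  refine tendstoInMeasure_of_tendsto_ae
    (fun n => ((hestm n).sub (hTlim.forall_aemeasurable n)).aestronglyMeasurable) ?_
  filter_upwards [hslim] with ω hω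
  refine tendsto_const_nhds.congr' ?_
  filter_upwards [eventually_all.2 fun j => (hω j).eventually_ne (hVar j)] with n hn
  ext j
  have hlinear := sqrt_mul_slopeHat_sub (fun i => w j (Qs i ω)) (fun i => u j (Qs i ω))
    P₀[W j] P₀[U j] (b j) (hn j)
  simp [hT, hg, hh, hZ, hs, hrbar, hr, ha, hlinear]

end SlopeCLT

end MarginalRegression

namespace MarginalRegression

/-! ### Scores of the 2p regressions and the matrix `DCD` -/

section Specialization

variable {Ω : Type*} [MeasurableSpace Ω] {P : Measure Ω} [IsProbabilityMeasure P]
  {p : ℕ} {Y : Ω → ℝ} {X : Fin p → Ω → ℝ}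

variable (P Y X) in
/-- The scores of the `2p` simple linear regressions: the products of the centered regressor and
of the least squares residual. -/
noncomputable def score : Fin p ⊕ Fin p → Ω → ℝ :=
  Sum.elim (fun j ω => (X j ω - P[X j]) * ((Y ω - P[Y]) - tau P Y X j * (X j ω - P[X j])))
    fun j ω => (Y ω - P[Y]) * ((X j ω - P[X j]) - theta P Y X j * (Y ω - P[Y]))

lemma score_inl_ae_eq (hY : MemLp Y 2 P) (hX : ∀ k, MemLp (X k) 2 P)
    (hVarX : ∀ j, 0 < Var[X j; P]) (j : Fin p) :
    score P Y X (Sum.inl j) =ᵐ[P] fun ω => (X j ω - P[X j]) * eps P hY hX j ω := by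
  filter_upwards [residual_ae_eq P hY (hX j) (hVarX j).ne'] with ω hω
  rw [eps, hω]
  rfl

lemma score_inr_ae_eq (hY : MemLp Y 2 P) (hX : ∀ k, MemLp (X k) 2 P)
    (hVarY : 0 < Var[Y; P]) (j : Fin p) :
    score P Y X (Sum.inr j) =ᵐ[P] fun ω => (Y ω - P[Y]) * err P hY hX j ω := by
  filter_upwards [residual_ae_eq P (hX j) hY hVarY.ne'] with ω hω
  rw [err, hω, covariance_comm]
  rfl

lemma memLp_score (hY : MemLp Y 2 P) (hX : ∀ k, MemLp (X k) 2 P) (hVarY : 0 < Var[Y; P])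
    (hVarX : ∀ j, 0 < Var[X j; P])
    (hε : ∀ j, Integrable (fun ω => (X j ω - P[X j]) ^ 2 * eps P hY hX j ω ^ 2) P)
    (he : ∀ j, Integrable (fun ω => (Y ω - P[Y]) ^ 2 * err P hY hX j ω ^ 2) P) :
    ∀ k, MemLp (score P Y X k) 2 P := by
  have hYm := hY.aestronglyMeasurable.aemeasurable
  have hXm (k : Fin p) := (hX k).aestronglyMeasurable.aemeasurable
  rintro (j | j)
  · have hm : AEStronglyMeasurable (score P Y X (Sum.inl j)) P :=
      (((hXm j).sub_const _).mul
        ((hYm.sub_const _).sub (((hXm j).sub_const _).const_mul _))).aestronglyMeasurable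
    refine (memLp_two_iff_integrable_sq hm).2 ((hε j).congr ?_)
    filter_upwards [score_inl_ae_eq hY hX hVarX j] with ω hω
    rw [hω, mul_pow]
  · have hm : AEStronglyMeasurable (score P Y X (Sum.inr j)) P :=
      ((hYm.sub_const _).mul
        (((hXm j).sub_const _).sub ((hYm.sub_const _).const_mul _))).aestronglyMeasurable
    refine (memLp_two_iff_integrable_sq hm).2 ((he j).congr ?_)
    filter_upwards [score_inr_ae_eq hY hX hVarY j] with ω hω
    rw [hω, mul_pow]

lemma matC_eq_secondMomentMatrix (hY : MemLp Y 2 P) (hX : ∀ k, MemLp (X k) 2 P)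
    (hVarY : 0 < Var[Y; P]) (hVarX : ∀ j, 0 < Var[X j; P]) :
    matC P hY hX = secondMomentMatrix P (score P Y X) := by
  ext (j | j) (k | k)
  · refine integral_congr_ae ?_
    filter_upwards [score_inl_ae_eq hY hX hVarX j, score_inl_ae_eq hY hX hVarX k] with ω h1 h2
    simp only [h1, h2]
    ring
  · refine integral_congr_ae ?_
    filter_upwards [score_inl_ae_eq hY hX hVarX j, score_inr_ae_eq hY hX hVarY k] with ω h1 h2
    simp only [h1, h2]
    ring
  · refine integral_congr_ae ?_
    filter_upwards [score_inr_ae_eq hY hX hVarY j, score_inl_ae_eq hY hX hVarX k] with ω h1 h2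
    simp only [h1, h2]
    ring
  · refine integral_congr_ae ?_
    filter_upwards [score_inr_ae_eq hY hX hVarY j, score_inr_ae_eq hY hX hVarY k] with ω h1 h2
    simp only [h1, h2]
    ring

lemma matD_mul_matC_mul_matD (hY : MemLp Y 2 P) (hX : ∀ k, MemLp (X k) 2 P)
    (hVarY : 0 < Var[Y; P]) (hVarX : ∀ j, 0 < Var[X j; P]) :
    matD P Y X * matC P hY hX * matD P Y X = secondMomentMatrix P fun k ω =>
      (Var[Sum.elim X (fun _ => Y) k; P])⁻¹ * score P Y X k ω := by
  have hD : matD P Y X =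
      Matrix.diagonal fun k => (Var[Sum.elim X (fun _ : Fin p => Y) k; P])⁻¹ := by
    rw [matD]
    congr 1
    ext (j | j) <;> rfl
  ext k l
  rw [hD, Matrix.mul_diagonal, Matrix.diagonal_mul, matC_eq_secondMomentMatrix hY hX hVarY hVarX,
    secondMomentMatrix, secondMomentMatrix, Matrix.of_apply, Matrix.of_apply,
    ← integral_const_mul, ← integral_mul_const]
  exact integral_congr_ae (ae_of_all _ fun ω => by simp only; ring)

/-- In the second block the roles of response and regressor are exchanged; the numerator is
symmetric in them. -/
lemma tauThetaHat_eq (n : ℕ) (y : ℕ → ℝ) (x : ℕ → Fin p → ℝ) :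
    tauThetaHat n y x = WithLp.toLp 2 fun k =>
      slopeHat n (fun i => Sum.elim (fun _ => y i) (x i) k)
        (fun i => Sum.elim (x i) (fun _ => y i) k) := by
  ext (j | j)
  · rfl
  · simp [tauThetaHat, thetaHat, slopeHat, mul_comm]

end Specialization

end MarginalRegression

theorem proposition6p1
    {Ω₀ : Type*} [MeasurableSpace Ω₀] (P₀ : Measure Ω₀) [IsProbabilityMeasure P₀]
    {Ω : Type*} [MeasurableSpace Ω] (P : Measure Ω) [IsProbabilityMeasure P]
    (p : ℕ)
    -- the square integrable random vector `(Y, X^(1), …, X^(p))`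
    (Y : Ω₀ → ℝ) (X : Fin p → Ω₀ → ℝ)
    (hY : MemLp Y 2 P₀) (hX : ∀ k, MemLp (X k) 2 P₀)
    -- its independent copies
    (Ys : ℕ → Ω → ℝ) (Xs : ℕ → Fin p → Ω → ℝ)
    (hindep : iIndepFun (fun i ω => (Ys i ω, fun k => Xs i k ω)) P)
    (hident : ∀ i, IdentDistrib (fun ω => (Ys i ω, fun k => Xs i k ω))
      (fun ω => (Y ω, fun k => X k ω)) P P₀)
    -- non-degeneracy and moment assumptions
    (hVarY : 0 < Var[Y; P₀]) (hVarX : ∀ j, 0 < Var[X j; P₀])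
    (hε : ∀ j, Integrable
      (fun ω => (X j ω - P₀[X j]) ^ 2 * MarginalRegression.eps P₀ hY hX j ω ^ 2) P₀)
    (he : ∀ j, Integrable
      (fun ω => (Y ω - P₀[Y]) ^ 2 * MarginalRegression.err P₀ hY hX j ω ^ 2) P₀) :
    (MarginalRegression.matD P₀ Y X * MarginalRegression.matC P₀ hY hX *
        MarginalRegression.matD P₀ Y X).PosSemidef ∧
      TendstoInDistribution
        (fun (n : ℕ) (ω : Ω) => Real.sqrt n •
          (MarginalRegression.tauThetaHat n (fun i => Ys i ω) (fun i k => Xs i k ω) -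
            MarginalRegression.tauTheta P₀ Y X))
        atTop id (fun _ => P)
        (multivariateGaussian 0
          (MarginalRegression.matD P₀ Y X * MarginalRegression.matC P₀ hY hX *
            MarginalRegression.matD P₀ Y X)) := by
  rw [MarginalRegression.matD_mul_matC_mul_matD hY hX hVarY hVarX]
  have hG2 := MarginalRegression.memLp_score hY hX hVarY hVarX hε he
  refine ⟨posSemidef_secondMomentMatrix fun k => (hG2 k).const_mul _, ?_⟩
  -- The left copy of `Fin p` has regressor X^(k) and response Y, the right copy the reverse. The
  -- slope in the right copy is `theta` by symmetry of the covariance.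
  have hclt := MarginalRegression.tendstoInDistribution_slopeHat hindep hident
    (u := Sum.elim (fun k q => q.2 k) fun _ q => q.1)
    (w := Sum.elim (fun _ q => q.1) fun k q => q.2 k)
    (U := Sum.elim X fun _ => Y) (W := Sum.elim (fun _ => Y) X)
    (b := Sum.elim (MarginalRegression.tau P₀ Y X) (MarginalRegression.theta P₀ Y X))
    (by rintro (j | j) <;> simp only [Sum.elim_inl, Sum.elim_inr] <;> fun_prop)
    (by rintro (j | j) <;> simp only [Sum.elim_inl, Sum.elim_inr] <;> fun_prop)
    (by rintro (j | j) ω <;> rfl) (by rintro (j | j) ω <;> rfl)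
    (by rintro (j | j); exacts [hX j, hY]) (by rintro (j | j); exacts [hY, hX j])
    (by rintro (j | j); exacts [(hVarX j).ne', hVarY.ne'])
    (by
      rintro (j | j)
      · rfl
      · simp only [Sum.elim_inr, MarginalRegression.theta, covariance_comm])
    (by rintro (j | j) ω <;> rfl) hG2
  convert hclt using 6 with n ω
  · rw [MarginalRegression.tauThetaHat_eq]
    ext (j | j) <;> rfl
  · rfl
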